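/- Let $G$ be a Carnot group: a connected, simply connected Lie group whose Lie algebra has a decomposition $\mathfrak g=V_1\oplus\cdots\oplus V_l$ with $[V_1,V_i]=V_{i+1}$ for $1\le i\le l-1$ and $[V_1,V_l]=0$. Let $\Sigma\subset TG$ be the horizontal bundle spanned by the left-invariant vector fields determined by elements of $V_1$ (the left-invariant horizontal vector fields), and let $g$ be a left-invariant Riemannian metric on $G$ for which $V_1$ is orthogonal to $V_2,\dots,V_l$. Let $\nabla$ be the Levi-Civita connection of $g$, let $\mathcal P$ be the $g$-orthogonal projection onto $\Sigma$, and let $D_XY=\mathcal P(\nabla_XY)$ be the horizontal connection on sections of $\Sigma$. A nonholonomic geodesic is a smooth curve $\gamma:J\to G$, defined on a nondegenerate interval $J$, with $\dot\gamma\in\Sigma$ and $D_{\dot\gamma}\dot\gamma=0$ (where, in a local orthonormal frame $X_1,\dots,X_k$ of $\Sigma$ with $D_{X_i}X_j=\Gamma_{ij}^rX_r$ and $\dot\gamma=\dot\gamma^iX_i$, one has $D_{\dot\gamma}\dot\gamma=\bigl(\tfrac{d}{dt}\dot\gamma^r+\dot\gamma^i\dot\gamma^j\Gamma_{ij}^r\bigr)X_r$).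 (1) A curve $\gamma:J\to G$ (in particular, any horizontal curve) is a nonholonomic geodesic if and only if it is an integral curve of some left-invariant horizontal vector field. Call a set $\Omega\subset G$ n-convex if, whenever two points of a nonholonomic geodesic lie in $\Omega$, the segment of that geodesic between them lies in $\Omega$; call a function $f:\Omega\to\mathbb R$ on an n-convex set n-convex if its restriction to every nonholonomic geodesic contained in $\Omega$ is convex. Call $\Omega$, respectively $f:\Omega\to\mathbb R$, h-convex if the same holds with the integral curves of left-invariant horizontal vector fields in place of nonholonomic geodesics. (2) A set $\Omega\subset G$ is n-convex if and only if it is h-convex, and a function $f:\Omega\to\mathbb R$ is n-convex if and only if it is h-convex. Both are equivalent to h-convexity in the form of Danielli, Garofalo and Nhieu: $\Omega$ is n-convex if and only if, for all $p\in\Omega$ and $v\in V_1$ with $p\exp(v)\in\Omega$ and all $s\in[0,1]$, one has $p\exp(sv)\in\Omega$; and $f$ is n-convex on $\Omega$ if and only if $\Omega$ has this property and $f(p\exp(sv))\le f(p)+s\,\bigl(f(p\exp(v))-f(p)\bigr)$ for all such $p,v,s$. -/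

import Mathlib

open Bundle Manifold Set VectorField
open scoped ContDiff Topology

noncomputable section

namespace SubRiem

variable {E : Type*} [NormedAddCommGroup E] [NormedSpace ℝ E]
  {H : Type*} [TopologicalSpace H] (I : ModelWithCorners ℝ E H)
  {M : Type*} [TopologicalSpace M] [ChartedSpace H M]

section Koszul

variable [RiemannianBundle (fun x : M => TangentSpace I x)]

/-- The Koszul expression: half of
`X⟨Y,Z⟩ + Y⟨Z,X⟩ - Z⟨X,Y⟩ + ⟨[X,Y],Z⟩ - ⟨[Y,Z],X⟩ - ⟨[X,Z],Y⟩`, evaluated at `x`. -/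
def koszul (X Y Z : Π x : M, TangentSpace I x) (x : M) : ℝ :=
  (1 / 2 : ℝ) *
    (mvfderiv I (fun y => inner ℝ (Y y) (Z y)) x (X x)
      + mvfderiv I (fun y => inner ℝ (Z y) (X y)) x (Y x)
      - mvfderiv I (fun y => inner ℝ (X y) (Y y)) x (Z x)
      + inner ℝ (mlieBracket I X Y x) (Z x)
      - inner ℝ (mlieBracket I Y Z x) (X x)
      - inner ℝ (mlieBracket I X Z x) (Y x))

variable {I}
variable [IsManifold I ∞ M]
  [IsContMDiffRiemannianBundle I ∞ E (fun x : M => TangentSpace I x)]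

theorem mdiffAt_inner {X Y : Π x : M, TangentSpace I x} {x : M}
    (hX : MDiffAt (T% X) x) (hY : MDiffAt (T% Y) x) :
    MDiffAt (fun y => inner ℝ (X y) (Y y)) x :=
  MDifferentiableAt.inner_bundle (IB := I) (F := E) (E := fun x : M => TangentSpace I x)
    (b := fun y => y) (v := X) (w := Y) hX hY

variable [FiniteDimensional ℝ E]

/-- The Koszul expression is tensorial in its last argument. -/
theorem koszul_tensorial {X Y : Π x : M, TangentSpace I x} {x : M}
    (hX : MDiffAt (T% X) x) (hY : MDiffAt (T% Y) x) :
    TensorialAt I E (fun Z : Π x : M, TangentSpace I x => koszul I X Y Z x) x := by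
  have : CompleteSpace E := FiniteDimensional.complete ℝ E
  have : IsManifold I 2 M := inferInstance
  constructor
  · intro f Z hf hZ
    have e1 : (fun y => inner ℝ (Y y) ((f • Z) y)) = fun y => f y * inner ℝ (Y y) (Z y) := by
      ext y; simp [inner_smul_right]
    have e2 : (fun y => inner ℝ ((f • Z) y) (X y)) = fun y => f y * inner ℝ (Z y) (X y) := by
      ext y; simp [inner_smul_left]
    simp only [koszul, e1, e2, mvfderiv_fun_mul hf (mdiffAt_inner hY hZ),
      mvfderiv_fun_mul hf (mdiffAt_inner hZ hX), mlieBracket_smul_right hf hZ]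
    simp [inner_add_left, inner_smul_left, inner_smul_right, real_inner_comm]
    ring
  · intro Z Z' hZ hZ'
    have e1 : (fun y => inner ℝ (Y y) ((Z + Z') y)) =
        fun y => inner ℝ (Y y) (Z y) + inner ℝ (Y y) (Z' y) := by
      ext y; simp [inner_add_right]
    have e2 : (fun y => inner ℝ ((Z + Z') y) (X y)) =
        fun y => inner ℝ (Z y) (X y) + inner ℝ (Z' y) (X y) := by
      ext y; simp [inner_add_left]
    simp only [koszul, e1, e2, mvfderiv_fun_add (mdiffAt_inner hY hZ) (mdiffAt_inner hY hZ'),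
      mvfderiv_fun_add (mdiffAt_inner hZ hX) (mdiffAt_inner hZ' hX), mlieBracket_add_right hZ hZ']
    simp [inner_add_left, inner_add_right]
    ring

/-- The Levi-Civita connection: `∇_X Y` at `x` is the tangent vector representing the Koszul
expression, `⟨∇_X Y, Z⟩ = koszul X Y Z` (with value `0` if `X` or `Y` is not differentiable
at `x`). -/
def leviCivita (X Y : Π x : M, TangentSpace I x) (x : M) : TangentSpace I x :=
  open Classical in
  have : FiniteDimensional ℝ (TangentSpace I x) := inferInstanceAs (FiniteDimensional ℝ E)
  have : CompleteSpace (TangentSpace I x) := FiniteDimensional.complete ℝ (TangentSpace I x)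
  if h : MDiffAt (T% X) x ∧ MDiffAt (T% Y) x then
    (InnerProductSpace.toDual ℝ (TangentSpace I x)).symm
      (TensorialAt.mkHom _ x (koszul_tensorial h.1 h.2))
  else 0

theorem inner_leviCivita {X Y Z : Π x : M, TangentSpace I x} {x : M} (hX : MDiffAt (T% X) x)
    (hY : MDiffAt (T% Y) x) (hZ : MDiffAt (T% Z) x) :
    inner ℝ (leviCivita X Y x) (Z x) = koszul I X Y Z x := by
  have h : MDiffAt (T% X) x ∧ MDiffAt (T% Y) x := ⟨hX, hY⟩
  have : FiniteDimensional ℝ (TangentSpace I x) := inferInstanceAs (FiniteDimensional ℝ E)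
  have : CompleteSpace (TangentSpace I x) := FiniteDimensional.complete ℝ (TangentSpace I x)
  simp only [leviCivita, dif_pos h]
  rw [InnerProductSpace.toDual_symm_apply]
  exact TensorialAt.mkHom_apply _ hZ

/-- The Levi-Civita connection is compatible with the metric. -/
theorem leviCivita_metric {X Y Z : Π x : M, TangentSpace I x} {x : M} (hX : MDiffAt (T% X) x)
    (hY : MDiffAt (T% Y) x) (hZ : MDiffAt (T% Z) x) :
    mvfderiv I (fun y => inner ℝ (Y y) (Z y)) x (X x) =
      inner ℝ (leviCivita X Y x) (Z x) + inner ℝ (Y x) (leviCivita X Z x) := by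
  rw [real_inner_comm (leviCivita X Z x), inner_leviCivita hX hY hZ, inner_leviCivita hX hZ hY]
  simp only [koszul, mlieBracket_swap_apply (V := Z) (W := Y), inner_neg_left,
    real_inner_comm]
  ring

/-- The Levi-Civita connection is torsion-free. -/
theorem leviCivita_torsion {X Y : Π x : M, TangentSpace I x} {x : M} (hX : MDiffAt (T% X) x)
    (hY : MDiffAt (T% Y) x) :
    leviCivita X Y x - leviCivita Y X x = mlieBracket I X Y x := by
  apply ext_inner_right ℝ
  intro v
  have hZ : MDiffAt (T% (FiberBundle.extend E v : Π y : M, TangentSpace I y)) x :=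
    FiberBundle.mdifferentiableAt_extend ..
  have hv : (FiberBundle.extend E v : Π y : M, TangentSpace I y) x = v := by simp
  rw [inner_sub_left, ← hv, inner_leviCivita hX hY hZ, inner_leviCivita hY hX hZ]
  simp only [koszul, mlieBracket_swap_apply (V := Y) (W := X), inner_neg_left,
    real_inner_comm]
  ring

end Koszul

section Horizontal

variable {I}
variable [FiniteDimensional ℝ E] [IsManifold I ∞ M]
  [RiemannianBundle (fun x : M => TangentSpace I x)]
  [IsContMDiffRiemannianBundle I ∞ E (fun x : M => TangentSpace I x)]

/-- The horizontal connection `D_X Y = P (∇_X Y)` of a distribution `Δ` (the horizontal bundle),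
where `P` is the orthogonal projection onto `Δ`. -/
def horizontalConnection (Δ : Π x : M, Submodule ℝ (TangentSpace I x))
    (X Y : Π x : M, TangentSpace I x) (x : M) : TangentSpace I x :=
  have : FiniteDimensional ℝ (TangentSpace I x) := inferInstanceAs (FiniteDimensional ℝ E)
  (Δ x).starProjection (leviCivita X Y x)

/-- `X₁, …, X_k` is a smooth orthonormal frame of the distribution `Δ` on the open set `U`. -/
structure IsOrthonormalFrame (Δ : Π x : M, Submodule ℝ (TangentSpace I x)) (U : Set M) {k : ℕ}
    (X : Fin k → Π x : M, TangentSpace I x) : Prop where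
  isOpen : IsOpen U
  smooth : ∀ i, ContMDiffOn I I.tangent ∞ (fun x => (⟨x, X i x⟩ : TangentBundle I M)) U
  orthonormal : ∀ x ∈ U, Orthonormal ℝ (fun i => X i x)
  span_eq : ∀ x ∈ U, Submodule.span ℝ (range fun i => X i x) = Δ x

/-- The velocity vector at time `t` of a curve `γ` defined on the interval `J`. -/
def velocity (I : ModelWithCorners ℝ E H) (γ : ℝ → M) (J : Set ℝ) (t : ℝ) :
    TangentSpace I (γ t) :=
  mfderivWithin 𝓘(ℝ, ℝ) I γ J t (1 : ℝ)

/-- The covariant derivative `DY/dt` at time `t` of a horizontal vector field `Y` along the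
horizontal curve `γ : J → M`, computed in a local orthonormal frame `X₁, …, X_k` of `Δ`: it equals
`∑ r, (dYʳ/dt + ∑ i j, γ'ⁱ Yʲ Γʳ_ij) X_r`, where `Yʲ = ⟨Y, X_j⟩`, `γ'ⁱ = ⟨γ', X_i⟩` are the
components in the frame and `Γʳ_ij = ⟨D_{X_i} X_j, X_r⟩`. -/
def covDerivAlong (Δ : Π x : M, Submodule ℝ (TangentSpace I x)) {k : ℕ}
    (X : Fin k → Π x : M, TangentSpace I x) (γ : ℝ → M) (J : Set ℝ)
    (Y : Π t : ℝ, TangentSpace I (γ t)) (t : ℝ) : TangentSpace I (γ t) :=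
  ∑ r, (derivWithin (fun s => inner ℝ (Y s) (X r (γ s))) J t
    + ∑ i, ∑ j, inner ℝ (velocity I γ J t) (X i (γ t)) * inner ℝ (Y t) (X j (γ t))
        * inner ℝ (horizontalConnection Δ (X i) (X j) (γ t)) (X r (γ t))) • X r (γ t)

/-- `γ`, restricted to the interval `J`, is a nonholonomic geodesic: a smooth horizontal curve
with `D_{γ'} γ' = 0`. The vector `D_{γ'} γ'` at time `t` is computed in a smooth orthonormal frame
of `Δ` near `γ t`; it does not depend on the frame. -/
structure IsNonholonomicGeodesic (Δ : Π x : M, Submodule ℝ (TangentSpace I x))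
    (γ : ℝ → M) (J : Set ℝ) : Prop where
  smooth : ContMDiffOn 𝓘(ℝ, ℝ) I ∞ γ J
  horizontal : ∀ t ∈ J, velocity I γ J t ∈ Δ (γ t)
  covDeriv_eq_zero : ∀ t ∈ J, ∃ (U : Set M) (k : ℕ) (X : Fin k → Π x : M, TangentSpace I x),
    γ t ∈ U ∧ IsOrthonormalFrame Δ U X ∧
      covDerivAlong Δ X γ J (fun s => velocity I γ J s) t = 0

/-- `Ω` is nonholonomically geodesic convex: it contains every nonholonomic geodesic segment
whose two end points lie in `Ω`. -/
def IsNConvexSet (Δ : Π x : M, Submodule ℝ (TangentSpace I x)) (Ω : Set M) : Prop :=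
  ∀ (γ : ℝ → M) (a b : ℝ), a < b → IsNonholonomicGeodesic Δ γ (Icc a b) →
    γ a ∈ Ω → γ b ∈ Ω → ∀ t ∈ Icc a b, γ t ∈ Ω

/-- A function is n-convex on `Ω` if `Ω` is n-convex and the restriction of the function to every
nonholonomic geodesic contained in `Ω` is convex. -/
def IsNConvexFun (Δ : Π x : M, Submodule ℝ (TangentSpace I x)) (Ω : Set M) (f : M → ℝ) : Prop :=
  IsNConvexSet Δ Ω ∧
    ∀ (γ : ℝ → M) (J : Set ℝ), J.OrdConnected → J.Nontrivial → IsNonholonomicGeodesic Δ γ J →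
      (∀ t ∈ J, γ t ∈ Ω) → ConvexOn ℝ J (fun t => f (γ t))

end Horizontal

section Carnot

variable (E : Type*) [NormedAddCommGroup E] [NormedSpace ℝ E]
  (G : Type*) [TopologicalSpace G] [ChartedSpace E G] [Group G]

/-- A stratification `V₁ ⊕ ⋯ ⊕ V_l` of the Lie algebra of `G`, with `[V₁, V_i] = V_{i+1}` for
`1 ≤ i ≤ l - 1` and `[V₁, V_l] = 0`. The layers are indexed by all natural numbers, with
`V_i = 0` for `i = 0` and for `i > l`. A Carnot group is a connected, simply connected Lie group
with a stratification of its Lie algebra. -/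
structure Stratification where
  layer : ℕ → Submodule ℝ (GroupLieAlgebra 𝓘(ℝ, E) G)
  step : ℕ
  one_le_step : 1 ≤ step
  isInternal : DirectSum.IsInternal layer
  layer_zero : layer 0 = ⊥
  layer_of_lt : ∀ i, step < i → layer i = ⊥
  bracket_layer : ∀ i, 1 ≤ i → i < step →
    Submodule.span ℝ {z | ∃ u ∈ layer 1, ∃ w ∈ layer i, z = ⁅u, w⁆} = layer (i + 1)
  bracket_last : ∀ u ∈ layer 1, ∀ w ∈ layer step, ⁅u, w⁆ = 0

variable {E G}

/-- The horizontal bundle: the left translates of the first layer. -/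
def Stratification.horizontalBundle (S : Stratification E G) (g : G) :
    Submodule ℝ (TangentSpace 𝓘(ℝ, E) g) :=
  Submodule.span ℝ {w | ∃ v ∈ S.layer 1, w = mulInvariantVectorField v g}

/-- The Riemannian metric of a Carnot group: left-invariant, with the first layer orthogonal to
the other layers. -/
structure Stratification.IsCarnotMetric (S : Stratification E G)
    [RiemannianBundle (fun x : G => TangentSpace 𝓘(ℝ, E) x)] : Prop where
  leftInvariant : ∀ (g : G) (v w : TangentSpace 𝓘(ℝ, E) (1 : G)),
    inner ℝ (mulInvariantVectorField v g) (mulInvariantVectorField w g) = inner ℝ v w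
  orthogonal : ∀ i, 2 ≤ i → ∀ v w : TangentSpace 𝓘(ℝ, E) (1 : G),
    v ∈ S.layer 1 → w ∈ S.layer i → inner ℝ v w = 0

/-- `Ω` is h-convex: if two points on an integral curve of a left-invariant horizontal vector
field belong to `Ω`, so does the segment of the integral curve between them. -/
def Stratification.IsHConvexSet (S : Stratification E G) (Ω : Set G) : Prop :=
  ∀ v ∈ S.layer 1, ∀ (γ : ℝ → G) (a b : ℝ), a < b →
    IsMIntegralCurveOn γ (mulInvariantVectorField v) (Icc a b) →
    γ a ∈ Ω → γ b ∈ Ω → ∀ t ∈ Icc a b, γ t ∈ Ω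

/-- A function is h-convex on `Ω` if `Ω` is h-convex and the function is convex along the integral
curves, contained in `Ω`, of the left-invariant horizontal vector fields. -/
def Stratification.IsHConvexFun (S : Stratification E G) (Ω : Set G) (f : G → ℝ) : Prop :=
  S.IsHConvexSet Ω ∧
    ∀ v ∈ S.layer 1, ∀ (γ : ℝ → G) (J : Set ℝ), J.OrdConnected → J.Nontrivial →
      IsMIntegralCurveOn γ (mulInvariantVectorField v) J →
      (∀ t ∈ J, γ t ∈ Ω) → ConvexOn ℝ J (fun t => f (γ t))

/-- The exponential map of a Lie group: the time-one value of the integral curve through the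
identity of the left-invariant vector field determined by `v` (which is always complete). -/
def lieExp (v : GroupLieAlgebra 𝓘(ℝ, E) G) : G :=
  open Classical in
  if h : ∃ γ : ℝ → G, γ 0 = 1 ∧ IsMIntegralCurve γ (mulInvariantVectorField v) then
    h.choose 1
  else 1

/-- h-convexity of `Ω` in the form of Danielli, Garofalo and Nhieu: if `p ∈ Ω` and `q ∈ Ω` lies in
the horizontal plane `{p exp(v) | v ∈ V₁}` through `p`, say `q = p exp(v)`, then
`p δ_s(p⁻¹ q) = p exp(s v)` lies in `Ω` for `0 ≤ s ≤ 1`, where `δ_s` are the dilations. -/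
def Stratification.IsDGNConvexSet (S : Stratification E G) (Ω : Set G) : Prop :=
  ∀ p ∈ Ω, ∀ v ∈ S.layer 1, p * lieExp v ∈ Ω → ∀ s ∈ Icc (0 : ℝ) 1, p * lieExp (s • v) ∈ Ω

/-- h-convexity of a function in the form of Danielli, Garofalo and Nhieu:
`f(p δ_s(p⁻¹ q)) ≤ f(p) + s (f(q) - f(p))` for `p, q ∈ Ω` with `q = p exp(v)`, `v ∈ V₁`, and
`0 ≤ s ≤ 1`, on a set `Ω` that is h-convex in the same sense. -/
def Stratification.IsDGNConvexFun (S : Stratification E G) (Ω : Set G) (f : G → ℝ) : Prop :=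
  S.IsDGNConvexSet Ω ∧
    ∀ p ∈ Ω, ∀ v ∈ S.layer 1, p * lieExp v ∈ Ω → ∀ s ∈ Icc (0 : ℝ) 1,
      f (p * lieExp (s • v)) ≤ f p + s * (f (p * lieExp v) - f p)

end Carnot

end SubRiem

end

/-! For left-invariant fields with values in V₁, the three derivative terms of the Koszul formula
vanish because inner products of left-invariant fields are constant. The three bracket terms vanish
because [V₁,V₁] lies in V₂, which is orthogonal to V₁, or is zero in step 1. Hence left-invariant
horizontal fields are D-parallel (`koszul_eq_zero`), and in a left-invariant orthonormal frame the
geodesic equation says that the components of γ' are constant.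

Since `IsNonholonomicGeodesic` allows a different frame at each time, the converse rests on a
product rule valid in any frame, `hasDerivWithinAt_inner_velocity`: (d/dt)⟨γ',W⟩ = ⟨D_{γ'}γ',W⟩ +
⟨γ',∇_{γ'}W⟩. For W left-invariant horizontal the last term is a vanishing Koszul expression.

So the two classes of curves coincide, and with them the two notions of convexity. The
Danielli–Garofalo–Nhieu form follows because these curves are t ↦ p exp(tv)
(`isMIntegralCurveOn_eq_lieExp`), up to an affine change of parameter. -/

noncomputable section

namespace SubRiem

/-! ### Regularity of integral curves. -/

section IntegralCurves

variable {E : Type*} [NormedAddCommGroup E] [NormedSpace ℝ E]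
  {H : Type*} [TopologicalSpace H] {I : ModelWithCorners ℝ E H}
  {M : Type*} [TopologicalSpace M] [ChartedSpace H M] [IsManifold I ∞ M]

/-- Integral curves of smooth vector fields are smooth. -/
theorem contMDiff_of_isMIntegralCurve {γ : ℝ → M} {V : Π x : M, TangentSpace I x}
    (hV : ContMDiff I I.tangent ∞ (fun x => (⟨x, V x⟩ : TangentBundle I M)))
    (hγ : IsMIntegralCurve γ V) : ContMDiff 𝓘(ℝ, ℝ) I ∞ γ := by
  rw [contMDiff_infty]
  intro n
  induction n with
  | zero => exact contMDiff_zero_iff.2 hγ.continuous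
  | succ n ih =>
    -- Bootstrapping: in the chart at `γ t₀` the derivative of the curve is `V ∘ γ` read in the
    -- trivialization, so it is Cⁿ as soon as `γ` is.
    intro t₀
    rw [contMDiffAt_iff_target]
    refine ⟨hγ.continuous.continuousAt, ?_⟩
    rw [contMDiffAt_iff_contDiffAt]
    have h1 := (hγ.isMIntegralCurveAt t₀).eventually_hasDerivAt
    have h2 := (contMDiffAt_section (γ t₀)).1 (hV (γ t₀))
    have h3 : ContMDiffAt 𝓘(ℝ, ℝ) 𝓘(ℝ, E) n (fun t =>
        (trivializationAt E (TangentSpace I : M → Type _) (γ t₀) ⟨γ t, V (γ t)⟩).2) t₀ :=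
      ContMDiffAt.comp (g := fun x => (trivializationAt E (TangentSpace I : M → Type _) (γ t₀)
        ⟨x, V x⟩).2) (f := γ) t₀ (h2.of_le (mod_cast le_top)) (ih t₀)
    rw [contMDiffAt_iff_contDiffAt] at h3
    push_cast
    rw [contDiffAt_succ_iff_hasFDerivAt]
    obtain ⟨u, hu, hd⟩ := Filter.eventually_iff_exists_mem.1 h1
    refine ⟨fun t => ContinuousLinearMap.toSpanSingleton ℝ
      (trivializationAt E (TangentSpace I : M → Type _) (γ t₀) ⟨γ t, V (γ t)⟩).2,
      ⟨u, hu, fun t ht => (hd t ht).hasFDerivAt⟩, ?_⟩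
    exact (ContinuousLinearMap.toSpanSingletonCLE (𝕜 := ℝ) (E := E)).contDiff.contDiffAt.comp t₀ h3

end IntegralCurves

/-! ### Left-invariant fields and the exponential map. -/

section LieGroup

variable {E : Type*} [NormedAddCommGroup E] [NormedSpace ℝ E]
  {G : Type*} [TopologicalSpace G] [ChartedSpace E G] [Group G] [LieGroup 𝓘(ℝ, E) ∞ G]

theorem lieGroup_minSmoothness : LieGroup 𝓘(ℝ, E) (minSmoothness ℝ 3) G := by
  rw [minSmoothness_of_isRCLikeNormedField]
  infer_instance

/-- The value at g is the tangent map of multiplication G × G → G applied to the pair (0 at g, v at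
1), a composite of smooth maps. -/
theorem contMDiff_leftInvariant (v : GroupLieAlgebra 𝓘(ℝ, E) G) :
    ContMDiff 𝓘(ℝ, E) 𝓘(ℝ, E).tangent ∞
      (fun g : G => (⟨g, mulInvariantVectorField v g⟩ : TangentBundle 𝓘(ℝ, E) G)) := by
  let I := 𝓘(ℝ, E)
  have M : (∞ : ℕ∞ω) ≠ 0 := by simp
  let fg : G → TangentBundle I G := fun g ↦ TotalSpace.mk' E g 0
  have sfg : CMDiff ∞ fg := contMDiff_zeroSection _ _
  let fv : G → TangentBundle I G := fun _ ↦ TotalSpace.mk' E 1 v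
  have sfv : CMDiff ∞ fv := contMDiff_const
  let F₁ : G → (TangentBundle I G × TangentBundle I G) := fun g ↦ (fg g, fv g)
  have S₁ : CMDiff ∞ F₁ := sfg.prodMk sfv
  let F₂ : (TangentBundle I G × TangentBundle I G) → TangentBundle (I.prod I) (G × G) :=
    (equivTangentBundleProd I G I G).symm
  have S₂ : CMDiff ∞ F₂ := contMDiff_equivTangentBundleProd_symm
  let F₃ : TangentBundle (I.prod I) (G × G) → TangentBundle I G :=
    tangentMap (I.prod I) I (fun (p : G × G) ↦ p.1 * p.2)
  have S₃ : CMDiff ∞ F₃ :=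
    ContMDiff.contMDiff_tangentMap (contMDiff_mul I ∞) (m := ∞) (by simp)
  convert! (S₃.comp S₂).comp S₁ with g
  · simp [F₁, F₂, F₃, fg, fv]
  · simp only [Function.comp_apply, tangentMap, F₃, F₂, F₁, fg, fv]
    rw [mfderiv_prod_eq_add_apply ((contMDiff_mul I ∞).mdifferentiableAt M)]
    change mfderiv I I (g * ·) 1 v =
      mfderiv I I (fun z : G => z * 1) g (0 : TangentSpace I g) + mfderiv I I (g * ·) 1 v
    rw [map_zero]
    exact (zero_add (mfderiv I I (g * ·) 1 v)).symm

theorem mdifferentiableAt_leftInvariant (v : GroupLieAlgebra 𝓘(ℝ, E) G) (g : G) :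
    MDiffAt (T% (mulInvariantVectorField v : Π x : G, TangentSpace 𝓘(ℝ, E) x)) g :=
  (contMDiff_leftInvariant v g).mdifferentiableAt (by simp)

/-- `v ↦ mulInvariantVectorField v g` as a linear map. -/
def leftInvariantAt (g : G) : GroupLieAlgebra 𝓘(ℝ, E) G →ₗ[ℝ] TangentSpace 𝓘(ℝ, E) g where
  toFun v := mulInvariantVectorField v g
  map_add' v w := congrFun (mulInvariantVectorField_add v w) g
  map_smul' c v := congrFun (mulInvariantVectorField_smul c v) g

theorem mfderiv_mul_left_leftInvariant (v : GroupLieAlgebra 𝓘(ℝ, E) G) (g h : G) :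
    mfderiv 𝓘(ℝ, E) 𝓘(ℝ, E) (g * ·) h (mulInvariantVectorField v h) =
      mulInvariantVectorField v (g * h) := by
  have M : (∞ : ℕ∞ω) ≠ 0 := by simp
  have D : (fun x => g * h * x) = (g * ·) ∘ (h * ·) := by ext x; simp [mul_assoc]
  have e := mfderiv_comp (I := 𝓘(ℝ, E)) (I' := 𝓘(ℝ, E)) (I'' := 𝓘(ℝ, E)) (1 : G)
    (g := (g * ·)) (f := (h * ·))
    ((contMDiff_mul_left (n := ∞)).contMDiffAt.mdifferentiableAt M)
    ((contMDiff_mul_left (n := ∞)).contMDiffAt.mdifferentiableAt M)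
  -- The chain rule for L_g ∘ L_h at 1 produces the derivative of L_g at `h * 1`. Reading
  -- derivatives as maps E → E allows this base point to be replaced by `h`.
  have key : ∀ k, k = h → (mfderiv 𝓘(ℝ, E) 𝓘(ℝ, E) (g * ·) k : E →L[ℝ] E) =
      mfderiv 𝓘(ℝ, E) 𝓘(ℝ, E) (g * ·) h := by
    rintro k rfl; rfl
  rw [mulInvariantVectorField, mulInvariantVectorField, D, e]
  exact (congrArg (fun L : E →L[ℝ] E => L (mfderiv 𝓘(ℝ, E) 𝓘(ℝ, E) (h * ·) 1 v))
    (key _ (mul_one h))).symm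

theorem isMIntegralCurveOn_mul_left {v : GroupLieAlgebra 𝓘(ℝ, E) G} {γ : ℝ → G} {J : Set ℝ}
    (hγ : IsMIntegralCurveOn γ (mulInvariantVectorField v) J) (g : G) :
    IsMIntegralCurveOn (fun t => g * γ t) (mulInvariantVectorField v) J := by
  intro t ht
  have h1 : HasMFDerivAt 𝓘(ℝ, E) 𝓘(ℝ, E) (g * ·) (γ t) _ :=
    ((contMDiff_mul_left (n := ∞)).contMDiffAt.mdifferentiableAt (by simp)).hasMFDerivAt
  have h2 := h1.comp_hasMFDerivWithinAt t (hγ t ht)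
  refine h2.congr_mfderiv ?_
  ext
  change mfderiv 𝓘(ℝ, E) 𝓘(ℝ, E) (g * ·) (γ t) ((1 : ℝ) • mulInvariantVectorField v (γ t)) =
    (1 : ℝ) • mulInvariantVectorField v (g * γ t)
  rw [map_smul, mfderiv_mul_left_leftInvariant]

theorem isMIntegralCurve_mul_left {v : GroupLieAlgebra 𝓘(ℝ, E) G} {γ : ℝ → G}
    (hγ : IsMIntegralCurve γ (mulInvariantVectorField v)) (g : G) :
    IsMIntegralCurve (fun t => g * γ t) (mulInvariantVectorField v) := by
  rw [isMIntegralCurve_iff_isMIntegralCurveOn] at *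
  exact isMIntegralCurveOn_mul_left hγ g

variable [T2Space G]

theorem isMIntegralCurve_unique {v : GroupLieAlgebra 𝓘(ℝ, E) G} {γ δ : ℝ → G} {t₀ : ℝ}
    (hγ : IsMIntegralCurve γ (mulInvariantVectorField v))
    (hδ : IsMIntegralCurve δ (mulInvariantVectorField v)) (h : γ t₀ = δ t₀) : γ = δ :=
  isMIntegralCurve_Ioo_eq_of_contMDiff_boundaryless
    ((contMDiff_leftInvariant v).of_le (by simp)) hγ hδ h

variable [FiniteDimensional ℝ E]

/-- Left-invariant vector fields are complete. -/
theorem exists_isMIntegralCurve_one (v : GroupLieAlgebra 𝓘(ℝ, E) G) :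
    ∃ γ : ℝ → G, γ 0 = 1 ∧ IsMIntegralCurve γ (mulInvariantVectorField v) := by
  have : CompleteSpace E := FiniteDimensional.complete ℝ E
  have hv := (contMDiff_leftInvariant (G := G) v).of_le (m := 1) (by simp)
  obtain ⟨γ, h0, hγ⟩ := exists_isMIntegralCurveAt_of_contMDiffAt_boundaryless 0 (hv 1)
  obtain ⟨ε, hε, h⟩ := isMIntegralCurveAt_iff'.1 hγ
  rw [Real.ball_eq_Ioo, zero_sub, zero_add] at h
  -- Left translates of one local curve through 1 give the same existence time ε at every point,
  -- which forces completeness.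
  exact exists_isMIntegralCurve_of_isMIntegralCurveOn hv hε
    (fun x => ⟨fun t => x * γ t, by simp [h0], isMIntegralCurveOn_mul_left h x⟩) 1

/-- `lieExp` chooses a curve separately for each vector. By uniqueness the curve for `t • v` is the
one for `v` run at speed t, so its value at time 1 is `γ t`. -/
theorem isMIntegralCurve_lieExp (v : GroupLieAlgebra 𝓘(ℝ, E) G) :
    IsMIntegralCurve (fun t : ℝ => lieExp (t • v)) (mulInvariantVectorField v) := by
  obtain ⟨γ, h0, hγ⟩ := exists_isMIntegralCurve_one v
  suffices h : ∀ t : ℝ, lieExp (t • v) = γ t by rwa [funext h]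
  intro t
  have h := exists_isMIntegralCurve_one (t • v)
  have e : h.choose = γ ∘ (· * t) := by
    refine isMIntegralCurve_unique (t₀ := 0) h.choose_spec.2 ?_ ?_
    · rw [mulInvariantVectorField_smul]
      exact hγ.comp_mul t
    · simp [h.choose_spec.1, h0]
  simp only [lieExp, dif_pos h]
  simp [e]

theorem lieExp_zero : lieExp (0 : GroupLieAlgebra 𝓘(ℝ, E) G) = 1 := by
  have h := exists_isMIntegralCurve_one (0 : GroupLieAlgebra 𝓘(ℝ, E) G)
  have hz : IsMIntegralCurve (fun t : ℝ => (1 : G))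
      (mulInvariantVectorField (0 : GroupLieAlgebra 𝓘(ℝ, E) G)) := by
    intro t
    refine (hasMFDerivAt_const (I := 𝓘(ℝ, ℝ)) (I' := 𝓘(ℝ, E)) (1 : G) t).congr_mfderiv ?_
    ext
    change 0 = (1 : ℝ) • leftInvariantAt (1 : G) 0
    simp
  rw [lieExp, dif_pos h, isMIntegralCurve_unique (t₀ := 0) h.choose_spec.2 hz h.choose_spec.1]

/-- Integral curves of left-invariant vector fields are left translates of one-parameter
subgroups. -/
theorem isMIntegralCurveOn_eq_lieExp {v : GroupLieAlgebra 𝓘(ℝ, E) G} {γ : ℝ → G} {J : Set ℝ}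
    (hJ : J.OrdConnected) (hγ : IsMIntegralCurveOn γ (mulInvariantVectorField v) J) {s t : ℝ}
    (hs : s ∈ J) (ht : t ∈ J) : γ t = γ s * lieExp ((t - s) • v) := by
  -- Uniqueness is applied on the open interval, starting from the midpoint; continuity then extends
  -- the equality to the end points, where only one-sided derivatives are given.
  have key : ∀ a b : ℝ, a < b → a ∈ J → b ∈ J → ∃ δ : ℝ → G,
      IsMIntegralCurve δ (mulInvariantVectorField v) ∧ EqOn γ δ (Icc a b) := by
    intro a b hab ha hb
    have hI := hJ.out ha hb
    let m := (a + b) / 2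
    have hm : m ∈ Ioo a b := ⟨by simp only [m]; linarith, by simp only [m]; linarith⟩
    have hδ := isMIntegralCurve_mul_left ((isMIntegralCurve_lieExp v).comp_add (-m)) (γ m)
    refine ⟨_, hδ, ?_⟩
    have h1 := isMIntegralCurveOn_Ioo_eqOn_of_contMDiff_boundaryless hm
      ((contMDiff_leftInvariant v).of_le (by simp)) (hγ.mono (Ioo_subset_Icc_self.trans hI))
      (hδ.isMIntegralCurveOn _) (by simp [lieExp_zero])
    exact h1.of_subset_closure
      (fun x hx => ((hγ.mono hI) x hx).continuousWithinAt) hδ.continuous.continuousOn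
      Ioo_subset_Icc_self (by rw [closure_Ioo hab.ne])
  have fin : ∀ δ : ℝ → G, IsMIntegralCurve δ (mulInvariantVectorField v) → γ s = δ s →
      γ t = δ t → γ t = γ s * lieExp ((t - s) • v) := by
    intro δ hδ e1 e2
    have h2 := isMIntegralCurve_mul_left ((isMIntegralCurve_lieExp v).comp_add (-s)) (γ s)
    rw [e2, isMIntegralCurve_unique (t₀ := s) hδ h2 (by simp [lieExp_zero, e1])]
    simp [sub_eq_add_neg]
  rcases lt_trichotomy s t with h | h | h
  · obtain ⟨δ, hδ, e⟩ := key s t h hs ht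
    exact fin δ hδ (e (left_mem_Icc.2 h.le)) (e (right_mem_Icc.2 h.le))
  · subst h; simp [lieExp_zero]
  · obtain ⟨δ, hδ, e⟩ := key t s h ht hs
    exact fin δ hδ (e (right_mem_Icc.2 h.le)) (e (left_mem_Icc.2 h.le))

theorem isMIntegralCurve_mul_lieExp (v : GroupLieAlgebra 𝓘(ℝ, E) G) (g : G) (s : ℝ) :
    IsMIntegralCurve (fun t => g * lieExp ((t - s) • v)) (mulInvariantVectorField v) := by
  simpa [Function.comp_def, sub_eq_add_neg] using
    isMIntegralCurve_mul_left ((isMIntegralCurve_lieExp v).comp_add (-s)) g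

/-- On J the curve is the restriction of a complete integral curve, so end points of J cause no loss
of smoothness. -/
theorem contMDiffOn_of_isMIntegralCurveOn {v : GroupLieAlgebra 𝓘(ℝ, E) G} {γ : ℝ → G} {J : Set ℝ}
    (hJ : J.OrdConnected) (hγ : IsMIntegralCurveOn γ (mulInvariantVectorField v) J) :
    ContMDiffOn 𝓘(ℝ, ℝ) 𝓘(ℝ, E) ∞ γ J := by
  intro s hs
  exact ((contMDiff_of_isMIntegralCurve (contMDiff_leftInvariant v)
    (isMIntegralCurve_mul_lieExp v (γ s) s)).contMDiffOn (s := J)).congr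
    (fun t ht => isMIntegralCurveOn_eq_lieExp hJ hγ hs ht) s hs

end LieGroup

/-! ### The product rule for the horizontal connection along a curve. -/

section Horizontal

variable {E : Type*} [NormedAddCommGroup E] [NormedSpace ℝ E]
  {H : Type*} [TopologicalSpace H] {I : ModelWithCorners ℝ E H}
  {M : Type*} [TopologicalSpace M] [ChartedSpace H M]

theorem uniqueDiffOn_of_ordConnected {J : Set ℝ} (hJ : J.OrdConnected) (hJn : J.Nontrivial) :
    UniqueDiffOn ℝ J := by
  refine uniqueDiffOn_convex hJ.convex ?_
  obtain ⟨a, ha, b, hb, hab⟩ := hJn.exists_lt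
  exact (nonempty_Ioo.2 hab).mono (interior_Icc (a := a) (b := b) ▸ interior_mono (hJ.out ha hb))

/-- The lifted velocity is the tangent map of γ composed with the unit section of Tℝ. -/
theorem mdifferentiableWithinAt_velocity [IsManifold I ∞ M] {γ : ℝ → M} {J : Set ℝ} (hJ : UniqueDiffOn ℝ J)
    (hγ : ContMDiffOn 𝓘(ℝ, ℝ) I ∞ γ J) {t : ℝ} (ht : t ∈ J) :
    MDifferentiableWithinAt 𝓘(ℝ, ℝ) I.tangent
      (fun s => (⟨γ s, velocity I γ J s⟩ : TangentBundle I M)) J t := by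
  have h1 := hγ.contMDiffOn_tangentMapWithin (m := 1) (by norm_cast) hJ.uniqueMDiffOn
  have h2 : ContMDiff 𝓘(ℝ, ℝ) 𝓘(ℝ, ℝ).tangent 1
      (fun s : ℝ => (⟨s, (1 : ℝ)⟩ : TangentBundle 𝓘(ℝ, ℝ) ℝ)) := by
    intro s
    exact contMDiffAt_vectorSpace_iff_contDiffAt.2 contDiffAt_const
  exact ((h1.comp (h2.contMDiffOn (s := J)) (fun s hs => hs)) t ht).mdifferentiableWithinAt
    (by simp)

theorem hasDerivWithinAt_comp_curve {γ : ℝ → M} {J : Set ℝ} {t : ℝ} {f : M → ℝ}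
    (hf : MDiffAt f (γ t)) (hγ : MDifferentiableWithinAt 𝓘(ℝ, ℝ) I γ J t) :
    HasDerivWithinAt (fun s => f (γ s)) (mvfderiv I f (γ t) (velocity I γ J t)) J t := by
  have h := hf.hasMFDerivAt.comp_hasMFDerivWithinAt t hγ.hasMFDerivWithinAt
  let L : ℝ →L[ℝ] ℝ := (mfderiv I 𝓘(ℝ, ℝ) f (γ t)).comp (mfderivWithin 𝓘(ℝ, ℝ) I γ J t)
  have h' : HasFDerivWithinAt (fun s => f (γ s)) L J t :=
    hasMFDerivWithinAt_iff_hasFDerivWithinAt.1 h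
  exact h'.hasDerivWithinAt

theorem sum_inner_smul_of_orthonormal {F : Type*} [NormedAddCommGroup F] [InnerProductSpace ℝ F]
    {ι : Type*} [Fintype ι] {b : ι → F} (hb : Orthonormal ℝ b) {u : F}
    (hu : u ∈ Submodule.span ℝ (range b)) : ∑ i, inner ℝ u (b i) • b i = u := by
  obtain ⟨a, rfl⟩ := Submodule.mem_span_range_iff_exists_fun ℝ |>.1 hu
  simp [hb.inner_left_fintype]

variable [IsManifold I ∞ M] [RiemannianBundle (fun x : M => TangentSpace I x)]
  [IsContMDiffRiemannianBundle I ∞ E (fun x : M => TangentSpace I x)]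
  [FiniteDimensional ℝ E]

/-- The Koszul expression is tensorial in its first argument. -/
theorem koszul_tensorial_left {Y Z : Π x : M, TangentSpace I x} {x : M}
    (hY : MDiffAt (T% Y) x) (hZ : MDiffAt (T% Z) x) :
    TensorialAt I E (fun X : Π x : M, TangentSpace I x => koszul I X Y Z x) x := by
  have : CompleteSpace E := FiniteDimensional.complete ℝ E
  have : IsManifold I 2 M := inferInstance
  constructor
  · intro f X hf hX
    have e1 : (fun y => inner ℝ (Z y) ((f • X) y)) = fun y => f y * inner ℝ (Z y) (X y) := by
      ext y; simp [inner_smul_right]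
    have e2 : (fun y => inner ℝ ((f • X) y) (Y y)) = fun y => f y * inner ℝ (X y) (Y y) := by
      ext y; simp [inner_smul_left]
    simp only [koszul, e1, e2, mvfderiv_fun_mul hf (mdiffAt_inner hZ hX),
      mvfderiv_fun_mul hf (mdiffAt_inner hX hY), mlieBracket_smul_left hf hX]
    simp [inner_add_left, inner_smul_left, inner_smul_right, real_inner_comm]
    ring
  · intro X X' hX hX'
    have e1 : (fun y => inner ℝ (Z y) ((X + X') y)) =
        fun y => inner ℝ (Z y) (X y) + inner ℝ (Z y) (X' y) := by
      ext y; simp [inner_add_right]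
    have e2 : (fun y => inner ℝ ((X + X') y) (Y y)) =
        fun y => inner ℝ (X y) (Y y) + inner ℝ (X' y) (Y y) := by
      ext y; simp [inner_add_left]
    simp only [koszul, e1, e2, mvfderiv_fun_add (mdiffAt_inner hZ hX) (mdiffAt_inner hZ hX'),
      mvfderiv_fun_add (mdiffAt_inner hX hY) (mdiffAt_inner hX' hY), mlieBracket_add_left hX hX']
    simp [inner_add_left, inner_add_right]
    ring

theorem inner_horizontalConnection {Δ : Π x : M, Submodule ℝ (TangentSpace I x)}
    {X Y : Π x : M, TangentSpace I x} {x : M} {u : TangentSpace I x} (hu : u ∈ Δ x) :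
    inner ℝ (horizontalConnection Δ X Y x) u = inner ℝ (leviCivita X Y x) u := by
  have : FiniteDimensional ℝ (TangentSpace I x) := inferInstanceAs (FiniteDimensional ℝ E)
  rw [horizontalConnection, Submodule.inner_starProjection_left_eq_right,
    Submodule.starProjection_eq_self_iff.2 hu]

theorem horizontalConnection_mem {Δ : Π x : M, Submodule ℝ (TangentSpace I x)}
    {X Y : Π x : M, TangentSpace I x} {x : M} : horizontalConnection Δ X Y x ∈ Δ x :=
  have : FiniteDimensional ℝ (TangentSpace I x) := inferInstanceAs (FiniteDimensional ℝ E)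
  Submodule.starProjection_apply_mem ..

/-- Along a horizontal curve, the derivative of `⟨γ', W⟩` for a horizontal field `W` is
`⟨D_{γ'} γ', W⟩ + ⟨γ', ∇_V W⟩`, for any field `V` with `V = γ'` at the point considered. -/
theorem hasDerivWithinAt_inner_velocity {Δ : Π x : M, Submodule ℝ (TangentSpace I x)}
    {γ : ℝ → M} {J : Set ℝ} (hJ : UniqueDiffOn ℝ J) (hγ : ContMDiffOn 𝓘(ℝ, ℝ) I ∞ γ J)
    (hor : ∀ t ∈ J, velocity I γ J t ∈ Δ (γ t)) {t : ℝ} (ht : t ∈ J) {U : Set M} {k : ℕ}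
    {X : Fin k → Π x : M, TangentSpace I x} (hU : γ t ∈ U) (hX : IsOrthonormalFrame Δ U X)
    {V W : Π x : M, TangentSpace I x} (hV : MDiffAt (T% V) (γ t)) (hW : MDiffAt (T% W) (γ t))
    (hWΔ : W (γ t) ∈ Δ (γ t)) (hVγ : V (γ t) = velocity I γ J t) :
    HasDerivWithinAt (fun s => inner ℝ (velocity I γ J s) (W (γ s)))
      (inner ℝ (covDerivAlong Δ X γ J (fun s => velocity I γ J s) t) (W (γ t))
        + koszul I V W V (γ t)) J t := by
  have hγt : MDifferentiableWithinAt 𝓘(ℝ, ℝ) I γ J t :=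
    (hγ t ht).mdifferentiableWithinAt (by simp)
  have hvel := mdifferentiableWithinAt_velocity hJ hγ ht
  have hXd : ∀ i, MDiffAt (T% (X i)) (γ t) := fun i =>
    ((hX.smooth i _ hU).contMDiffAt (hX.isOpen.mem_nhds hU)).mdifferentiableAt (by simp)
  have hUJ : ∀ᶠ s in 𝓝[J] t, γ s ∈ U :=
    hγt.continuousWithinAt.preimage_mem_nhdsWithin (hX.isOpen.mem_nhds hU)
  have hexp : ∀ x ∈ U, ∀ u ∈ Δ x, ∑ i, inner ℝ u (X i x) • X i x = u := fun x hx u hu =>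
    sum_inner_smul_of_orthonormal (hX.orthonormal x hx) (by rw [hX.span_eq x hx]; exact hu)
  -- the coefficients of the velocity
  have hc : ∀ r, DifferentiableWithinAt ℝ
      (fun s => inner ℝ (velocity I γ J s) (X r (γ s))) J t := by
    intro r
    have h1 : MDifferentiableWithinAt 𝓘(ℝ, ℝ) I.tangent
        (fun s => (⟨γ s, X r (γ s)⟩ : TangentBundle I M)) J t :=
      (hXd r).comp_mdifferentiableWithinAt t hγt
    have h2 := MDifferentiableWithinAt.inner_bundle (IB := I) (F := E)
      (E := fun x : M => TangentSpace I x) (b := γ) (v := fun s => velocity I γ J s)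
      (w := fun s => X r (γ s)) hvel h1
    exact mdifferentiableWithinAt_iff_differentiableWithinAt.1 h2
  have hd : ∀ r, HasDerivWithinAt (fun s => inner ℝ (X r (γ s)) (W (γ s)))
      (mvfderiv I (fun y => inner ℝ (X r y) (W y)) (γ t) (velocity I γ J t)) J t := fun r =>
    hasDerivWithinAt_comp_curve (mdiffAt_inner (hXd r) hW) hγt
  have hsum := HasDerivWithinAt.fun_sum (u := Finset.univ)
    (fun r _ => (hc r).hasDerivWithinAt.mul (hd r))
  -- The frame expansion holds only while the curve stays in `U`, so it is used as an equality of
  -- germs at t within J.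
  have heq : ∀ s, γ s ∈ U → s ∈ J → inner ℝ (velocity I γ J s) (W (γ s)) =
      ∑ r, inner ℝ (velocity I γ J s) (X r (γ s)) * inner ℝ (X r (γ s)) (W (γ s)) := by
    intro s hs hsJ
    conv_lhs => rw [← hexp _ hs _ (hor s hsJ)]
    simp [sum_inner, inner_smul_left]
  refine (hsum.congr_of_eventuallyEq ?_ (heq t hU ht)).congr_deriv ?_
  · filter_upwards [hUJ, self_mem_nhdsWithin] with s h1 h2 using heq s h1 h2
  set c : Fin k → ℝ := fun i => inner ℝ (velocity I γ J t) (X i (γ t))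
  have hvt : velocity I γ J t = ∑ i, c i • X i (γ t) := (hexp _ hU _ (hor t ht)).symm
  -- the derivative of `⟨X_r, W⟩` in the direction of the velocity
  have hm : ∀ r, mvfderiv I (fun y => inner ℝ (X r y) (W y)) (γ t) (velocity I γ J t) =
      ∑ i, c i * (inner ℝ (leviCivita (X i) (X r) (γ t)) (W (γ t))
        + inner ℝ (X r (γ t)) (leviCivita (X i) W (γ t))) := by
    intro r
    rw [hvt, map_sum]
    refine Finset.sum_congr rfl fun i _ => ?_
    rw [map_smul, leviCivita_metric (hXd i) (hXd r) hW, smul_eq_mul]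
  -- Since `W` is horizontal at the point, ∇ may be replaced by its projection D, which brings in
  -- the Christoffel symbols.
  have hΓ : ∀ i r, inner ℝ (leviCivita (X i) (X r) (γ t)) (W (γ t)) =
      ∑ q, inner ℝ (horizontalConnection Δ (X i) (X r) (γ t)) (X q (γ t))
        * inner ℝ (X q (γ t)) (W (γ t)) := by
    intro i r
    rw [← inner_horizontalConnection hWΔ]
    conv_lhs => rw [← hexp _ hU _ (horizontalConnection_mem (Δ := Δ) (X := X i) (Y := X r))]
    simp only [sum_inner, real_inner_smul_left]
  -- the remaining term is tensorial
  have hk : ∑ r, ∑ i, c r * (c i * inner ℝ (X r (γ t)) (leviCivita (X i) W (γ t))) =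
      koszul I V W V (γ t) := by
    -- `V` equals ∑ cᵢ Xᵢ only at the point `γ t`; tensoriality in the first slot makes that enough.
    have hT := koszul_tensorial_left (I := I) (Y := W) (Z := V) hW hV
    have hVs : ∀ i, ∑ r, c r * inner ℝ (X r (γ t)) (leviCivita (X i) W (γ t)) =
        koszul I (X i) W V (γ t) := by
      intro i
      rw [← inner_leviCivita (hXd i) hW hV, hVγ, hvt, inner_sum]
      refine Finset.sum_congr rfl fun r _ => ?_
      rw [real_inner_smul_right, real_inner_comm]
    rw [← TensorialAt.mkHom_apply hT hV, hVγ, hvt, map_sum, Finset.sum_comm]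
    refine Finset.sum_congr rfl fun i _ => ?_
    rw [map_smul, TensorialAt.mkHom_apply hT (hXd i), ← hVs, smul_eq_mul, Finset.mul_sum]
    exact Finset.sum_congr rfl fun r _ => by ring
  simp only [hm, covDerivAlong, sum_inner, real_inner_smul_left, ← hk, hΓ]
  simp only [mul_add, Finset.mul_sum, Finset.sum_add_distrib, add_mul, Finset.sum_mul]
  rw [← add_assoc]
  congr 2
  -- What remains is one triple sum of Christoffel terms with its indices in two different orders.
  rw [Finset.sum_congr rfl fun r _ => Finset.sum_comm, Finset.sum_comm]
  refine Finset.sum_congr rfl fun q _ => ?_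
  rw [Finset.sum_comm]
  exact Finset.sum_congr rfl fun i _ => Finset.sum_congr rfl fun r _ => by ring

end Horizontal

/-! ### Nonholonomic geodesics of a Carnot group. -/

section Carnot

variable {E : Type*} [NormedAddCommGroup E] [NormedSpace ℝ E]
  {G : Type*} [TopologicalSpace G] [ChartedSpace E G]

theorem velocity_of_isMIntegralCurveOn {γ : ℝ → G} {J : Set ℝ} (hJ : UniqueDiffOn ℝ J)
    {V : Π x : G, TangentSpace 𝓘(ℝ, E) x} (hγ : IsMIntegralCurveOn γ V J) {t : ℝ} (ht : t ∈ J) :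
    velocity 𝓘(ℝ, E) γ J t = V (γ t) := by
  rw [velocity, (hγ t ht).mfderivWithin (hJ.uniqueMDiffOn t ht)]
  exact one_smul ℝ (V (γ t))

variable [Group G]

theorem Stratification.mem_horizontalBundle [LieGroup 𝓘(ℝ, E) ∞ G] (S : Stratification E G) {g : G}
    {u : TangentSpace 𝓘(ℝ, E) g} :
    u ∈ S.horizontalBundle g ↔ ∃ v ∈ S.layer 1, u = mulInvariantVectorField v g := by
  have : {w | ∃ v ∈ S.layer 1, w = mulInvariantVectorField v g} =
      ((S.layer 1).map (leftInvariantAt g) : Set (TangentSpace 𝓘(ℝ, E) g)) := by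
    ext w
    simp only [Submodule.map_coe, mem_image, mem_ofPred_eq, SetLike.mem_coe]
    exact ⟨fun ⟨v, h1, h2⟩ => ⟨v, h1, h2.symm⟩, fun ⟨v, h1, h2⟩ => ⟨v, h1, h2.symm⟩⟩
  rw [horizontalBundle, this, Submodule.span_eq, Submodule.mem_map]
  exact ⟨fun ⟨v, h1, h2⟩ => ⟨v, h1, h2.symm⟩, fun ⟨v, h1, h2⟩ => ⟨v, h1, h2.symm⟩⟩

variable [RiemannianBundle (fun x : G => TangentSpace 𝓘(ℝ, E) x)]

/-- The bracket relations and the orthogonality of the layers enter only here. In step at least 2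
the bracket lies in V₂; in step 1 it vanishes by `bracket_last`. -/
theorem Stratification.IsCarnotMetric.inner_bracket {S : Stratification E G}
    (hS : S.IsCarnotMetric) {u v w : TangentSpace 𝓘(ℝ, E) (1 : G)} (hu : u ∈ S.layer 1)
    (hv : v ∈ S.layer 1) (hw : w ∈ S.layer 1) :
    inner ℝ (mlieBracket 𝓘(ℝ, E) (mulInvariantVectorField u) (mulInvariantVectorField v) (1 : G))
      w = 0 := by
  rcases S.one_le_step.lt_or_eq with h | h
  · rw [real_inner_comm]
    refine hS.orthogonal 2 le_rfl _ _ hw ?_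
    rw [← S.bracket_layer 1 le_rfl h]
    exact Submodule.subset_span ⟨u, hu, v, hv, rfl⟩
  · rw [show mlieBracket 𝓘(ℝ, E) (mulInvariantVectorField u) (mulInvariantVectorField v) (1 : G) = 0
      from S.bracket_last u hu v (h ▸ hv), inner_zero_left]

variable [LieGroup 𝓘(ℝ, E) ∞ G] [FiniteDimensional ℝ E]

/-- The bracket of left-invariant fields and the metric are both left-invariant, so the identity
element suffices. -/
theorem Stratification.IsCarnotMetric.inner_mlieBracket {S : Stratification E G}
    (hS : S.IsCarnotMetric) {u v w : TangentSpace 𝓘(ℝ, E) (1 : G)} (hu : u ∈ S.layer 1)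
    (hv : v ∈ S.layer 1) (hw : w ∈ S.layer 1) (g : G) :
    inner ℝ (mlieBracket 𝓘(ℝ, E) (mulInvariantVectorField u) (mulInvariantVectorField v) g)
      (mulInvariantVectorField w g) = 0 := by
  have := lieGroup_minSmoothness (E := E) (G := G)
  have : CompleteSpace E := FiniteDimensional.complete ℝ E
  rw [← mulInvariantVector_mlieBracket, hS.leftInvariant]
  exact hS.inner_bracket hu hv hw

/-- Left-invariant horizontal fields are parallel for the horizontal connection. -/
theorem Stratification.IsCarnotMetric.koszul_eq_zero {S : Stratification E G}
    (hS : S.IsCarnotMetric) {u v w : TangentSpace 𝓘(ℝ, E) (1 : G)} (hu : u ∈ S.layer 1)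
    (hv : v ∈ S.layer 1) (hw : w ∈ S.layer 1) (g : G) :
    koszul 𝓘(ℝ, E) (mulInvariantVectorField u) (mulInvariantVectorField v)
      (mulInvariantVectorField w) g = 0 := by
  simp only [koszul, hS.leftInvariant, mvfderiv_const, hS.inner_mlieBracket hu hv hw,
    hS.inner_mlieBracket hv hw hu, hS.inner_mlieBracket hu hw hv]
  simp

/-- Left translation of an orthonormal basis of V₁ is isometric, hence gives a global frame. -/
theorem Stratification.IsCarnotMetric.exists_frame {S : Stratification E G}
    (hS : S.IsCarnotMetric) : ∃ (k : ℕ) (b : Fin k → TangentSpace 𝓘(ℝ, E) (1 : G)),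
      (∀ i, b i ∈ S.layer 1) ∧
      IsOrthonormalFrame S.horizontalBundle univ (fun i => mulInvariantVectorField (b i)) := by
  have : FiniteDimensional ℝ (TangentSpace 𝓘(ℝ, E) (1 : G)) :=
    inferInstanceAs (FiniteDimensional ℝ E)
  let L : Submodule ℝ (TangentSpace 𝓘(ℝ, E) (1 : G)) := S.layer 1
  let B := stdOrthonormalBasis ℝ L
  refine ⟨_, fun i => B i, fun i => (B i).2, isOpen_univ,
    fun i => (contMDiff_leftInvariant _).contMDiffOn, fun g _ => ?_, fun g _ => ?_⟩
  · have h := B.orthonormal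
    rw [orthonormal_iff_ite] at h ⊢
    intro i j
    rw [hS.leftInvariant, ← h i j]
    rfl
  · have h : Submodule.span ℝ (range fun i => (B i : TangentSpace 𝓘(ℝ, E) (1 : G))) = L := by
      have := congrArg (Submodule.map L.subtype) B.toBasis.span_eq
      rw [Submodule.map_span, ← range_comp] at this
      simpa [Function.comp_def] using this
    have h2 := congrArg (Submodule.map (leftInvariantAt g)) h
    rw [Submodule.map_span, ← range_comp] at h2
    refine h2.trans ?_
    ext w
    rw [S.mem_horizontalBundle, Submodule.mem_map]
    exact ⟨fun ⟨v, h1, h2⟩ => ⟨v, h1, h2.symm⟩, fun ⟨v, h1, h2⟩ => ⟨v, h1, h2.symm⟩⟩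

variable [IsContMDiffRiemannianBundle 𝓘(ℝ, E) ∞ E (fun x : G => TangentSpace 𝓘(ℝ, E) x)]

/-- In the global left-invariant frame the velocity has constant components and all Christoffel
symbols vanish, so both terms of the geodesic equation are zero. -/
theorem Stratification.IsCarnotMetric.isNonholonomicGeodesic [T2Space G] {S : Stratification E G}
    (hS : S.IsCarnotMetric) {γ : ℝ → G} {J : Set ℝ} (hJ : J.OrdConnected) (hJn : J.Nontrivial)
    {v : TangentSpace 𝓘(ℝ, E) (1 : G)} (hv : v ∈ S.layer 1)
    (hγ : IsMIntegralCurveOn γ (mulInvariantVectorField v) J) :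
    IsNonholonomicGeodesic S.horizontalBundle γ J := by
  have hU := uniqueDiffOn_of_ordConnected hJ hJn
  have hvel : ∀ t ∈ J, velocity 𝓘(ℝ, E) γ J t = mulInvariantVectorField v (γ t) :=
    fun t ht => velocity_of_isMIntegralCurveOn hU hγ ht
  obtain ⟨k, b, hb, hX⟩ := hS.exists_frame
  refine ⟨contMDiffOn_of_isMIntegralCurveOn hJ hγ, fun t ht => ?_, fun t ht =>
    ⟨univ, k, _, mem_univ _, hX, ?_⟩⟩
  · rw [hvel t ht]
    exact S.mem_horizontalBundle.2 ⟨v, hv, rfl⟩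
  · refine Finset.sum_eq_zero fun r _ => ?_
    have h1 : derivWithin (fun s => inner ℝ (velocity 𝓘(ℝ, E) γ J s)
        (mulInvariantVectorField (b r) (γ s))) J t = 0 := by
      rw [derivWithin_congr (f := fun _ => inner ℝ v (b r)) (fun s hs => by
        rw [hvel s hs, hS.leftInvariant]) (by rw [hvel t ht, hS.leftInvariant])]
      simp
    have h2 : ∀ i j, inner ℝ (horizontalConnection S.horizontalBundle
        (mulInvariantVectorField (b i)) (mulInvariantVectorField (b j)) (γ t))
          (mulInvariantVectorField (b r) (γ t)) = 0 := by
      intro i j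
      rw [inner_horizontalConnection (S.mem_horizontalBundle.2 ⟨b r, hb r, rfl⟩),
        inner_leviCivita (mdifferentiableAt_leftInvariant _ _)
          (mdifferentiableAt_leftInvariant _ _) (mdifferentiableAt_leftInvariant _ _),
        hS.koszul_eq_zero (hb i) (hb j) (hb r)]
    simp only [h1, h2]
    simp

/-- The velocity, translated back to the identity, is a curve `v` in V₁; testing it against every w
∈ V₁ shows that it is constant. -/
theorem Stratification.IsCarnotMetric.exists_isMIntegralCurveOn {S : Stratification E G}
    (hS : S.IsCarnotMetric) {γ : ℝ → G} {J : Set ℝ} (hJ : J.OrdConnected) (hJn : J.Nontrivial)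
    (hγ : IsNonholonomicGeodesic S.horizontalBundle γ J) :
    ∃ v ∈ S.layer 1, IsMIntegralCurveOn γ (mulInvariantVectorField v) J := by
  have hU := uniqueDiffOn_of_ordConnected hJ hJn
  have hex : ∀ t, ∃ v : TangentSpace 𝓘(ℝ, E) (1 : G), t ∈ J → v ∈ S.layer 1 ∧
      velocity 𝓘(ℝ, E) γ J t = mulInvariantVectorField v (γ t) := by
    intro t
    by_cases ht : t ∈ J
    · obtain ⟨v, h1, h2⟩ := S.mem_horizontalBundle.1 (hγ.horizontal t ht)
      exact ⟨v, fun _ => ⟨h1, h2⟩⟩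
    · exact ⟨0, fun h => absurd h ht⟩
  choose v hv using hex
  have hder : ∀ w ∈ S.layer 1, ∀ t ∈ J, HasDerivWithinAt (fun s => inner ℝ
      (velocity 𝓘(ℝ, E) γ J s) (mulInvariantVectorField w (γ s))) 0 J t := by
    intro w hw t ht
    obtain ⟨U, k, X, hUt, hX, h0⟩ := hγ.covDeriv_eq_zero t ht
    -- With t fixed, the left-invariant field of `v t` extends the velocity at that instant, so the
    -- error term is a Koszul expression of left-invariant horizontal fields.
    have h := hasDerivWithinAt_inner_velocity hU hγ.smooth hγ.horizontal ht hUt hX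
      (mdifferentiableAt_leftInvariant (v t) _) (mdifferentiableAt_leftInvariant w _)
      (S.mem_horizontalBundle.2 ⟨w, hw, rfl⟩) (hv t ht).2.symm
    rwa [h0, inner_zero_left, hS.koszul_eq_zero (hv t ht).1 hw (hv t ht).1, add_zero] at h
  have hconst : ∀ w ∈ S.layer 1, ∀ s ∈ J, ∀ t ∈ J, inner ℝ (v s) w = inner ℝ (v t) w := by
    intro w hw s hs t ht
    have h := hJ.convex.is_const_of_fderivWithin_eq_zero (𝕜 := ℝ)
      (fun x hx => (hder w hw x hx).differentiableWithinAt) (fun x hx => by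
        rw [(hder w hw x hx).hasFDerivWithinAt.fderivWithin (hU x hx)]; simp) hs ht
    simpa only [(hv s hs).2, (hv t ht).2, hS.leftInvariant] using h
  obtain ⟨t₀, ht₀⟩ := hJn.nonempty
  refine ⟨v t₀, (hv t₀ ht₀).1, fun t ht => ?_⟩
  -- Pairings are controlled only against V₁, but the difference itself lies in V₁ and is thus
  -- orthogonal to itself.
  have hvt : v t = v t₀ := by
    rw [← sub_eq_zero, ← inner_self_eq_zero (𝕜 := ℝ), inner_sub_left, sub_eq_zero]
    exact hconst _ (Submodule.sub_mem _ (hv t ht).1 (hv t₀ ht₀).1) t ht t₀ ht₀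
  refine ((hγ.smooth t ht).mdifferentiableWithinAt (by simp)).hasMFDerivWithinAt.congr_mfderiv ?_
  ext
  rw [← hvt, ← (hv t ht).2]
  exact (one_smul ℝ (velocity 𝓘(ℝ, E) γ J t)).symm

end Carnot

/-! ### Comparison with convexity in the sense of Danielli, Garofalo and Nhieu. -/

section Convexity

theorem nontrivial_Icc_of_lt {a b : ℝ} (h : a < b) : (Icc a b).Nontrivial :=
  ⟨a, left_mem_Icc.2 h.le, b, right_mem_Icc.2 h.le, h.ne⟩

variable {E : Type*} [NormedAddCommGroup E] [NormedSpace ℝ E] [FiniteDimensional ℝ E]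
  {G : Type*} [TopologicalSpace G] [ChartedSpace E G] [Group G] [LieGroup 𝓘(ℝ, E) ∞ G]
  [T2Space G] (S : Stratification E G)

theorem Stratification.isHConvexSet_iff_isDGNConvexSet (Ω : Set G) :
    S.IsHConvexSet Ω ↔ S.IsDGNConvexSet Ω := by
  constructor
  · intro h p hp v hv hq s hs
    have := h v hv _ 0 1 one_pos ((isMIntegralCurve_mul_lieExp v p 0).isMIntegralCurveOn _)
    simp only [sub_zero, zero_smul, lieExp_zero, mul_one, one_smul] at this
    exact this hp hq s hs
  · intro h v hv γ a b hab hγ ha hb t ht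
    have hba : 0 < b - a := sub_pos.2 hab
    have e : ∀ x ∈ Icc a b, γ x = γ a * lieExp ((x - a) • v) := fun x hx =>
      isMIntegralCurveOn_eq_lieExp ordConnected_Icc hγ (left_mem_Icc.2 hab.le) hx
    -- Rescaling `v` by b - a turns [a, b] into the unit interval, on which t becomes (t - a)/(b -
    -- a).
    have := h (γ a) ha ((b - a) • v) (Submodule.smul_mem _ _ hv)
      (by rwa [← e b (right_mem_Icc.2 hab.le)]) ((t - a) / (b - a))
      ⟨div_nonneg (sub_nonneg.2 ht.1) hba.le, (div_le_one hba).2 (by linarith [ht.2])⟩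
    rwa [smul_smul, div_mul_cancel₀ _ hba.ne', ← e t ht] at this

theorem Stratification.isHConvexFun_iff_isDGNConvexFun (Ω : Set G) (f : G → ℝ) :
    S.IsHConvexFun Ω f ↔ S.IsDGNConvexFun Ω f := by
  rw [IsHConvexFun, IsDGNConvexFun, S.isHConvexSet_iff_isDGNConvexSet]
  refine and_congr_right fun hΩ => ?_
  constructor
  · intro h p hp v hv hq s hs
    have hc := h v hv _ (Icc 0 1) ordConnected_Icc (nontrivial_Icc_of_lt one_pos)
      ((isMIntegralCurve_mul_lieExp v p 0).isMIntegralCurveOn _)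
      (fun t ht => by simpa using hΩ p hp v hv hq t ht)
    have := hc.2 (left_mem_Icc.2 zero_le_one) (right_mem_Icc.2 zero_le_one)
      (sub_nonneg.2 hs.2) hs.1 (by ring)
    simp only [smul_eq_mul, mul_zero, mul_one, zero_add, sub_zero, zero_smul, lieExp_zero,
      one_smul] at this
    linarith
  · intro h v hv γ J hJ _ hγ hJΩ
    refine ⟨hJ.convex, fun x hx y hy a b ha hb hab => ?_⟩
    have hz : a • x + b • y ∈ J := hJ.convex hx hy ha hb hab
    -- No order between x and y is needed: V₁ is a subspace, so y - x may have either sign. The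
    -- weight `b` of y serves as the parameter s.
    have := h (γ x) (hJΩ x hx) ((y - x) • v) (Submodule.smul_mem _ _ hv)
      (by rw [← isMIntegralCurveOn_eq_lieExp hJ hγ hx hy]; exact hJΩ y hy) b
      ⟨hb, by linarith⟩
    obtain rfl : a = 1 - b := by linarith
    have e : b * (y - x) = ((1 - b) • x + b • y) - x := by simp only [smul_eq_mul]; ring
    rw [smul_smul, e, ← isMIntegralCurveOn_eq_lieExp hJ hγ hx hz,
      ← isMIntegralCurveOn_eq_lieExp hJ hγ hx hy] at this
    simp only [smul_eq_mul] at this ⊢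
    linarith

end Convexity

end SubRiem

end


theorem mainTheorem8 {E : Type*} [NormedAddCommGroup E] [NormedSpace ℝ E] [FiniteDimensional ℝ E]
    {G : Type*} [TopologicalSpace G] [ChartedSpace E G] [Group G] [LieGroup 𝓘(ℝ, E) ∞ G]
    [T2Space G] [SimplyConnectedSpace G]
    [RiemannianBundle (fun x : G => TangentSpace 𝓘(ℝ, E) x)]
    [IsContMDiffRiemannianBundle 𝓘(ℝ, E) ∞ E (fun x : G => TangentSpace 𝓘(ℝ, E) x)]
    (S : SubRiem.Stratification E G) (hS : S.IsCarnotMetric) :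
    (∀ (γ : ℝ → G) (J : Set ℝ), J.OrdConnected → J.Nontrivial →
      (SubRiem.IsNonholonomicGeodesic S.horizontalBundle γ J ↔
        ∃ v ∈ S.layer 1, IsMIntegralCurveOn γ (mulInvariantVectorField v) J)) ∧
    (∀ Ω : Set G,
      (SubRiem.IsNConvexSet S.horizontalBundle Ω ↔ S.IsHConvexSet Ω) ∧
      (SubRiem.IsNConvexSet S.horizontalBundle Ω ↔ S.IsDGNConvexSet Ω)) ∧
    (∀ (Ω : Set G) (f : G → ℝ),
      (SubRiem.IsNConvexFun S.horizontalBundle Ω f ↔ S.IsHConvexFun Ω f) ∧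
      (SubRiem.IsNConvexFun S.horizontalBundle Ω f ↔ S.IsDGNConvexFun Ω f)) := by
  have key : ∀ (γ : ℝ → G) (J : Set ℝ), J.OrdConnected → J.Nontrivial →
      (SubRiem.IsNonholonomicGeodesic S.horizontalBundle γ J ↔
        ∃ v ∈ S.layer 1, IsMIntegralCurveOn γ (mulInvariantVectorField v) J) :=
    fun γ J hJ hJn => ⟨hS.exists_isMIntegralCurveOn hJ hJn,
      fun ⟨_, hv, h⟩ => hS.isNonholonomicGeodesic hJ hJn hv h⟩
  -- The two convexity notions differ only in their test curves, which `key` identifies on every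
  -- nondegenerate interval.
  have hset : ∀ Ω : Set G, SubRiem.IsNConvexSet S.horizontalBundle Ω ↔ S.IsHConvexSet Ω := by
    intro Ω
    constructor
    · intro h v hv γ a b hab hγ
      exact h γ a b hab ((key γ _ ordConnected_Icc (SubRiem.nontrivial_Icc_of_lt hab)).2 ⟨v, hv, hγ⟩)
    · intro h γ a b hab hγ
      obtain ⟨v, hv, hγ'⟩ := (key γ _ ordConnected_Icc (SubRiem.nontrivial_Icc_of_lt hab)).1 hγ
      exact h v hv γ a b hab hγ'
  have hfun : ∀ (Ω : Set G) (f : G → ℝ),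
      SubRiem.IsNConvexFun S.horizontalBundle Ω f ↔ S.IsHConvexFun Ω f := by
    intro Ω f
    refine and_congr (hset Ω) ⟨fun h v hv γ J hJ hJn hγ => ?_, fun h γ J hJ hJn hγ => ?_⟩
    · exact h γ J hJ hJn ((key γ J hJ hJn).2 ⟨v, hv, hγ⟩)
    · obtain ⟨v, hv, hγ'⟩ := (key γ J hJ hJn).1 hγ
      exact h v hv γ J hJ hJn hγ'
  exact ⟨key, fun Ω => ⟨hset Ω, (hset Ω).trans (S.isHConvexSet_iff_isDGNConvexSet Ω)⟩,
    fun Ω f => ⟨hfun Ω f, (hfun Ω f).trans (S.isHConvexFun_iff_isDGNConvexFun Ω f)⟩⟩
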